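/- Let $\mathbb H$ be the quaternions and $\mathbb S=\{I\in\mathbb H: I^2=-1\}$; for $I\in\mathbb S$ put $\mathbb C_I=\mathbb R+I\mathbb R$. A map $F=F_1+F_2\imath:\mathbb C\to\mathbb H\otimes_{\mathbb R}\mathbb C$ (with $F_1,F_2:\mathbb C\to\mathbb H$, $\imath=1\otimes i$) is a stem function if $F(\bar z)=\overline{F(z)}$, where $\overline{p+q\imath}=p-q\imath$. A function $f:\mathbb H\to\mathbb H$ is a slice function if there is a stem function $F$ with $f(\alpha+I\beta)=F_1(\alpha+i\beta)+IF_2(\alpha+i\beta)$ for all $\alpha,\beta\in\mathbb R$, $I\in\mathbb S$; it is slice regular if, in addition, $F$ is holomorphic, and slice-preserving if it is a slice function with $f(\mathbb C_J)\subset\mathbb C_J$ for all $J\in\mathbb S$. For a $C^1$ function $f$ and $q\in\mathbb C_I\setminus\mathbb R$ let $\partial_*f(q)=\frac12(\partial_1f-I\,\partial_If)(q)$ and $\bar\partial_*f(q)=\frac12(\partial_1f+I\,\partial_If)(q)$, where $\partial_v$ is the directional derivative in the direction $v$, and for $C^2$ functions let $\Delta_*f=4\,\partial_*\bar\partial_*f$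 on $\mathbb H\setminus\mathbb R$. For $w\in\mathbb S$ let $S_w(q)=w^{-1}qw$ and $(R_wf)(q)=S_w^{-1}(f(S_w(q)))$, let $\mu$ be the rotation invariant probability measure on $\mathbb S$, and set $\Delta'f=\Delta_*\int_{\mathbb S}R_wf\,d\mu(w)$. Let $h:\mathbb H\to\mathbb R$ be a $C^2$ slice function (as a function with values in $\mathbb R\subset\mathbb H$) with $\Delta'h=0$ on $\mathbb H\setminus\mathbb R$. Then there exists a slice-preserving slice regular function $f:\mathbb H\to\mathbb H$ such that $h(q)=\operatorname{Re}(f(q))$ for all $q\in\mathbb H$. -/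

import Mathlib

open scoped Quaternion

namespace SliceQuat

noncomputable section

/-- The 2-sphere of imaginary units of the quaternions. -/
def imUnits : Set ℍ[ℝ] := {I | I ^ 2 = -1}

/-- The slice `ℂ_I = ℝ + I ℝ`. -/
def slice (I : ℍ[ℝ]) : Set ℍ[ℝ] := {x | ∃ α β : ℝ, x = (α : ℍ[ℝ]) + I * (β : ℍ[ℝ])}

/-! ### Stem functions and slice functions

An element `p + q ι` of the complexification `ℍ ⊗_ℝ ℂ` is written as the pair `(p, q)`. -/

/-- Multiplication by `ι = 1 ⊗ i` on `ℍ ⊗ ℂ`: `(p + q ι) ι = -q + p ι`. -/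
def mulIota (v : ℍ[ℝ] × ℍ[ℝ]) : ℍ[ℝ] × ℍ[ℝ] := (-v.2, v.1)

/-- Complex conjugation on `ℍ ⊗ ℂ`: `p + q ι ↦ p - q ι`. -/
def conjIota (v : ℍ[ℝ] × ℍ[ℝ]) : ℍ[ℝ] × ℍ[ℝ] := (v.1, -v.2)

/-- `F : ℂ → ℍ ⊗ ℂ` is a stem function: `F(z̄)` is the conjugate of `F(z)`. -/
def IsStem (F : ℂ → ℍ[ℝ] × ℍ[ℝ]) : Prop :=
  ∀ z : ℂ, F (starRingEnd ℂ z) = conjIota (F z)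

/-- `F = F₁ + F₂ ι` induces `f`: `f(α + I β) = F₁(α + i β) + I F₂(α + i β)` for all real
`α`, `β` and all imaginary units `I`. -/
def Induces (F : ℂ → ℍ[ℝ] × ℍ[ℝ]) (f : ℍ[ℝ] → ℍ[ℝ]) : Prop :=
  ∀ α β : ℝ, ∀ I ∈ imUnits,
    f ((α : ℍ[ℝ]) + I * (β : ℍ[ℝ])) = (F ⟨α, β⟩).1 + I * (F ⟨α, β⟩).2

/-- (Left) slice functions on `ℍ`. -/
def IsSlice (f : ℍ[ℝ] → ℍ[ℝ]) : Prop :=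
  ∃ F : ℂ → ℍ[ℝ] × ℍ[ℝ], IsStem F ∧ Induces F f

/-- `F : ℂ → ℍ ⊗ ℂ` is holomorphic: it is real differentiable and
`∂F/∂β = ι ∂F/∂α`, that is, `∂F/∂z̄ = (∂F/∂α + ι ∂F/∂β) / 2 = 0`. -/
def IsHolomorphic (F : ℂ → ℍ[ℝ] × ℍ[ℝ]) : Prop :=
  Differentiable ℝ F ∧ ∀ z : ℂ, fderiv ℝ F z Complex.I = mulIota (fderiv ℝ F z 1)

/-- (Left) slice regular functions on `ℍ`: slice functions whose stem function is holomorphic. -/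
def IsSliceRegular (f : ℍ[ℝ] → ℍ[ℝ]) : Prop :=
  ∃ F : ℂ → ℍ[ℝ] × ℍ[ℝ], IsStem F ∧ Induces F f ∧ IsHolomorphic F

/-- Slice-preserving functions: slice functions mapping every slice `ℂ_J` into itself. -/
def IsSlicePreserving (f : ℍ[ℝ] → ℍ[ℝ]) : Prop :=
  IsSlice f ∧ ∀ J ∈ imUnits, ∀ q ∈ slice J, f q ∈ slice J

/-! ### The operators `∂_*`, `∂̄_*`, `Δ_*` -/

/-- The imaginary unit `I = Im q / |Im q|` with `q ∈ ℂ_I`, for `q ∉ ℝ`. The operators below do not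
change if `I` is replaced by the other choice `-I`. -/
def unitOf (q : ℍ[ℝ]) : ℍ[ℝ] := ‖q.im‖⁻¹ • q.im

/-- `∂_* f = (∂_1 - I ∂_I) f / 2` at points `q ∈ ℂ_I \ ℝ`. -/
def dStar (f : ℍ[ℝ] → ℍ[ℝ]) (q : ℍ[ℝ]) : ℍ[ℝ] :=
  (1 / 2 : ℝ) • (lineDeriv ℝ f q 1 - unitOf q * lineDeriv ℝ f q (unitOf q))

/-- `∂̄_* f = (∂_1 + I ∂_I) f / 2` at points `q ∈ ℂ_I \ ℝ`. -/
def dBarStar (f : ℍ[ℝ] → ℍ[ℝ]) (q : ℍ[ℝ]) : ℍ[ℝ] :=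
  (1 / 2 : ℝ) • (lineDeriv ℝ f q 1 + unitOf q * lineDeriv ℝ f q (unitOf q))

/-- `Δ_* f = 4 ∂_* ∂̄_* f` (for `C²` functions `f`, at non-real points). -/
def laplaceStar (f : ℍ[ℝ] → ℍ[ℝ]) (q : ℍ[ℝ]) : ℍ[ℝ] :=
  (4 : ℝ) • dStar (dBarStar f) q

/-! ### Rotations, averaging, and `Δ'` -/

/-- `S_w(q) = w⁻¹ q w`. -/
def rotS (w q : ℍ[ℝ]) : ℍ[ℝ] := w⁻¹ * q * w

/-- `(R_w f)(q) = S_w⁻¹(f(S_w(q)))`, where the inverse of `S_w` is `S_{w⁻¹}`. -/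
def rotR (w : ℍ[ℝ]) (f : ℍ[ℝ] → ℍ[ℝ]) (q : ℍ[ℝ]) : ℍ[ℝ] := rotS w⁻¹ (f (rotS w q))

/-- The isometry from the unit sphere of `ℝ³` onto the imaginary units. -/
def toUnit (v : Metric.sphere (0 : EuclideanSpace ℝ (Fin 3)) 1) : ℍ[ℝ] :=
  ⟨0, v.1 0, v.1 1, v.1 2⟩

/-- `∫_𝕊 R_w f dμ(w)`, where `μ` is the rotation invariant probability measure on the sphere of
imaginary units (the normalized surface measure). -/
def rotAverage (f : ℍ[ℝ] → ℍ[ℝ]) (q : ℍ[ℝ]) : ℍ[ℝ] :=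
  ⨍ v : Metric.sphere (0 : EuclideanSpace ℝ (Fin 3)) 1, rotR (toUnit v) f q
    ∂((MeasureTheory.volume : MeasureTheory.Measure (EuclideanSpace ℝ (Fin 3))).toSphere)

/-- `Δ' f = Δ_* ∫_𝕊 R_w f dμ(w)`. -/
def laplacePrime (f : ℍ[ℝ] → ℍ[ℝ]) : ℍ[ℝ] → ℍ[ℝ] := laplaceStar (rotAverage f)

end

end SliceQuat

open scoped Topology
open Filter InnerProductSpace

namespace SliceQuat

/-! ### Imaginary units -/

/-! A real-valued slice function depends only on `q.re` and `‖q.im‖` (`IsSlice.eq_of_real`).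
Conjugation by units therefore fixes it, the average in `Δ'` is invisible, and the hypothesis
becomes `Δ_* h = 0`. For real values `Δ_*` is the planar Laplacian along the slice
(`laplaceStar_coe`), so `h` restricted to the slice of `imagI` is harmonic on `ℂ`, hence the real
part of an entire `G`. As `h` is even in the imaginary variable, `G` can be symmetrised to a `g`
commuting with conjugation; then `Re g + (Im g) ι` is a holomorphic stem function with real
components, and it induces `f`. -/

lemma re_eq_zero_of_mem_imUnits {I : ℍ[ℝ]} (hI : I ∈ imUnits) : I.re = 0 := by
  have h : I * I = -1 := by rw [← pow_two]; exact hI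
  have h0 := congrArg (·.re) h
  have h1 := congrArg (·.imI) h
  have h2 := congrArg (·.imJ) h
  have h3 := congrArg (·.imK) h
  simp only [Quaternion.re_mul, Quaternion.imI_mul, Quaternion.imJ_mul, Quaternion.imK_mul,
    Quaternion.re_neg, Quaternion.imI_neg, Quaternion.imJ_neg, Quaternion.imK_neg,
    Quaternion.re_one, Quaternion.imI_one, Quaternion.imJ_one, Quaternion.imK_one] at h0 h1 h2 h3
  by_contra hr
  have e1 : I.imI = 0 := by
    have : I.re * I.imI = 0 := by linarith
    exact (mul_eq_zero.1 this).resolve_left hr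
  have e2 : I.imJ = 0 := by
    have : I.re * I.imJ = 0 := by linarith
    exact (mul_eq_zero.1 this).resolve_left hr
  have e3 : I.imK = 0 := by
    have : I.re * I.imK = 0 := by linarith
    exact (mul_eq_zero.1 this).resolve_left hr
  rw [e1, e2, e3] at h0
  nlinarith [mul_self_nonneg I.re]

lemma im_eq_self_of_mem_imUnits {I : ℍ[ℝ]} (hI : I ∈ imUnits) : I.im = I := by
  ext <;> simp [re_eq_zero_of_mem_imUnits hI]

lemma norm_eq_one_of_mem_imUnits {I : ℍ[ℝ]} (hI : I ∈ imUnits) : ‖I‖ = 1 := by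
  have h : ‖I‖ ^ 2 = 1 := by
    rw [← norm_pow, show I ^ 2 = -1 from hI]
    simp
  exact (pow_eq_one_iff_of_nonneg (norm_nonneg I) two_ne_zero).1 h

lemma neg_mem_imUnits {I : ℍ[ℝ]} (hI : I ∈ imUnits) : -I ∈ imUnits := by
  change (-I) ^ 2 = -1
  rw [neg_sq]
  exact hI

lemma rotS_mem_imUnits {w I : ℍ[ℝ]} (hw : w ≠ 0) (hI : I ∈ imUnits) : rotS w I ∈ imUnits := by
  have h : I * I = -1 := by rw [← pow_two]; exact hI
  change (w⁻¹ * I * w) ^ 2 = -1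
  calc (w⁻¹ * I * w) ^ 2 = w⁻¹ * I * (w * w⁻¹) * I * w := by simp only [pow_two, mul_assoc]
    _ = w⁻¹ * (I * I) * w := by rw [mul_inv_cancel₀ hw]; simp only [mul_one, mul_assoc]
    _ = -1 := by rw [h, mul_neg, mul_one, neg_mul, inv_mul_cancel₀ hw]

/-- The quaternion `i`. -/
def imagI : ℍ[ℝ] := ⟨0, 1, 0, 0⟩

/-- The quaternion `j`. -/
def imagJ : ℍ[ℝ] := ⟨0, 0, 1, 0⟩

@[simp] lemma re_imagI : imagI.re = 0 := rfl
@[simp] lemma imI_imagI : imagI.imI = 1 := rfl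
@[simp] lemma imJ_imagI : imagI.imJ = 0 := rfl
@[simp] lemma imK_imagI : imagI.imK = 0 := rfl
@[simp] lemma re_imagJ : imagJ.re = 0 := rfl
@[simp] lemma imI_imagJ : imagJ.imI = 0 := rfl
@[simp] lemma imJ_imagJ : imagJ.imJ = 1 := rfl
@[simp] lemma imK_imagJ : imagJ.imK = 0 := rfl

lemma imagI_mem_imUnits : imagI ∈ imUnits := by
  change imagI ^ 2 = -1
  rw [pow_two]
  ext <;> simp

lemma imagJ_mem_imUnits : imagJ ∈ imUnits := by
  change imagJ ^ 2 = -1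
  rw [pow_two]
  ext <;> simp

lemma coeComplex_eq (z : ℂ) : (z : ℍ[ℝ]) = (z.re : ℍ[ℝ]) + imagI * (z.im : ℍ[ℝ]) := by
  ext <;> simp

lemma unitOf_mul_self {q : ℍ[ℝ]} (hq : q.im ≠ 0) : unitOf q * unitOf q = -1 := by
  have hn : ‖q.im‖ ≠ 0 := norm_ne_zero_iff.2 hq
  have h : q.im * q.im = -((‖q.im‖ * ‖q.im‖ : ℝ) : ℍ[ℝ]) := by
    rw [← Quaternion.normSq_eq_norm_mul_self, ← pow_two]
    exact Quaternion.sq_eq_neg_normSq.2 (by simp)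
  rw [unitOf, smul_mul_smul_comm, h, ← Quaternion.coe_neg, Quaternion.smul_coe]
  have : ‖q.im‖⁻¹ * ‖q.im‖⁻¹ * -(‖q.im‖ * ‖q.im‖) = -1 := by field_simp
  rw [this]
  simp

lemma unitOf_mem_imUnits {q : ℍ[ℝ]} (hq : q.im ≠ 0) : unitOf q ∈ imUnits := by
  change unitOf q ^ 2 = -1
  rw [pow_two, unitOf_mul_self hq]

lemma norm_smul_unitOf {q : ℍ[ℝ]} (hq : q.im ≠ 0) : ‖q.im‖ • unitOf q = q.im :=
  smul_inv_smul₀ (norm_ne_zero_iff.2 hq) _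

lemma exists_imUnits_eq (q : ℍ[ℝ]) :
    ∃ I ∈ imUnits, q = (q.re : ℍ[ℝ]) + I * (‖q.im‖ : ℍ[ℝ]) := by
  by_cases hq : q.im = 0
  · refine ⟨_, imagI_mem_imUnits, ?_⟩
    rw [hq, norm_zero, Quaternion.coe_zero, mul_zero]
    conv_lhs => rw [← Quaternion.re_add_im q, hq]
  · refine ⟨_, unitOf_mem_imUnits hq, ?_⟩
    rw [Quaternion.mul_coe_eq_smul, norm_smul_unitOf hq, Quaternion.re_add_im]

lemma re_add_mul_coe {I : ℍ[ℝ]} (hI : I ∈ imUnits) (α β : ℝ) :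
    ((α : ℍ[ℝ]) + I * (β : ℍ[ℝ])).re = α := by
  simp [re_eq_zero_of_mem_imUnits hI]

lemma im_add_mul_coe {I : ℍ[ℝ]} (hI : I ∈ imUnits) (α β : ℝ) :
    ((α : ℍ[ℝ]) + I * (β : ℍ[ℝ])).im = β • I := by
  conv_rhs => rw [← im_eq_self_of_mem_imUnits hI]
  rw [Quaternion.mul_coe_eq_smul]
  simp

lemma norm_im_add_mul_coe {I : ℍ[ℝ]} (hI : I ∈ imUnits) (α β : ℝ) :
    ‖((α : ℍ[ℝ]) + I * (β : ℍ[ℝ])).im‖ = |β| := by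
  rw [im_add_mul_coe hI, norm_smul, norm_eq_one_of_mem_imUnits hI, mul_one, Real.norm_eq_abs]

lemma unitOf_add_mul_coe {I : ℍ[ℝ]} (hI : I ∈ imUnits) (α β : ℝ) :
    unitOf ((α : ℍ[ℝ]) + I * (β : ℍ[ℝ])) = (|β|⁻¹ * β) • I := by
  rw [unitOf, norm_im_add_mul_coe hI, im_add_mul_coe hI, smul_smul]

/-! ### Real-valued slice functions are rotation invariant -/

/-- Comparing the values at `K` and `-K` shows that `K * F₂` is real for every unit `K`, so `F₂`
lies on every line `ℝK` and must vanish. -/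
lemma IsSlice.eq_of_real {h : ℍ[ℝ] → ℝ} (hs : IsSlice fun q => (h q : ℍ[ℝ])) (α β : ℝ)
    {I J : ℍ[ℝ]} (hI : I ∈ imUnits) (hJ : J ∈ imUnits) :
    h ((α : ℍ[ℝ]) + I * (β : ℍ[ℝ])) = h ((α : ℍ[ℝ]) + J * (β : ℍ[ℝ])) := by
  obtain ⟨F, -, hF⟩ := hs
  obtain ⟨a, b, hab⟩ : ∃ a b, F ⟨α, β⟩ = (a, b) := ⟨_, _, rfl⟩
  have key : ∀ K ∈ imUnits, ∃ r : ℝ, K * b = (r : ℍ[ℝ]) := fun K hK => by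
    have h1 := hF α β K hK
    have h2 := hF α β (-K) (neg_mem_imUnits hK)
    simp only [hab] at h1 h2
    refine ⟨(h ((α : ℍ[ℝ]) + K * (β : ℍ[ℝ])) - h ((α : ℍ[ℝ]) + -K * (β : ℍ[ℝ]))) / 2, ?_⟩
    have h3 : (2 : ℝ) • (K * b) = ((h ((α : ℍ[ℝ]) + K * (β : ℍ[ℝ])) -
        h ((α : ℍ[ℝ]) + -K * (β : ℍ[ℝ])) : ℝ) : ℍ[ℝ]) := by
      rw [Quaternion.coe_sub, h1, h2, two_smul]
      noncomm_ring
    rw [div_eq_inv_mul, ← Quaternion.smul_coe, ← h3, inv_smul_smul₀ two_ne_zero]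
  have hb : b = 0 := by
    -- Two units suffice: `i b` real puts `b` in `ℝi`, and `j b` real then kills the remaining
    -- `i`-component.
    obtain ⟨r, hr⟩ := key _ imagI_mem_imUnits
    obtain ⟨s, hs⟩ := key _ imagJ_mem_imUnits
    have r1 := congrArg (·.imI) hr
    have r2 := congrArg (·.imJ) hr
    have r3 := congrArg (·.imK) hr
    have s1 := congrArg (·.imK) hs
    simp only [Quaternion.imI_mul, Quaternion.imJ_mul, Quaternion.imK_mul, re_imagI, imI_imagI,
      imJ_imagI, imK_imagI, re_imagJ, imI_imagJ, imJ_imagJ, imK_imagJ, Quaternion.imI_coe,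
      Quaternion.imJ_coe, Quaternion.imK_coe] at r1 r2 r3 s1
    ext
    · change b.re = 0
      linarith
    · change b.imI = 0
      linarith
    · change b.imJ = 0
      linarith
    · change b.imK = 0
      linarith
  have h1 := hF α β I hI
  have h2 := hF α β J hJ
  simp only [hab, hb, mul_zero] at h1 h2
  exact Quaternion.coe_injective (h1.trans h2.symm)

lemma rotS_add_mul_coe {w : ℍ[ℝ]} (hw : w ≠ 0) (I : ℍ[ℝ]) (α β : ℝ) :
    rotS w ((α : ℍ[ℝ]) + I * (β : ℍ[ℝ])) = (α : ℍ[ℝ]) + rotS w I * (β : ℍ[ℝ]) := by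
  simp only [rotS, mul_add, add_mul]
  congr 1
  · rw [mul_assoc, Quaternion.coe_mul_eq_smul, mul_smul_comm, inv_mul_cancel₀ hw]
    simp [Quaternion.smul_coe, ← Quaternion.coe_one]
  · simp only [Quaternion.mul_coe_eq_smul, mul_smul_comm, smul_mul_assoc]

lemma IsSlice.apply_rotS {h : ℍ[ℝ] → ℝ} (hs : IsSlice fun q => (h q : ℍ[ℝ])) {w : ℍ[ℝ]}
    (hw : w ≠ 0) (q : ℍ[ℝ]) : h (rotS w q) = h q := by
  obtain ⟨I, hI, hq⟩ := exists_imUnits_eq q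
  rw [hq, rotS_add_mul_coe hw]
  exact hs.eq_of_real _ _ (rotS_mem_imUnits hw hI) hI

lemma rotS_coe {w : ℍ[ℝ]} (hw : w ≠ 0) (r : ℝ) : rotS w (r : ℍ[ℝ]) = r := by
  simpa using rotS_add_mul_coe hw 0 r 0

lemma toUnit_ne_zero (v : Metric.sphere (0 : EuclideanSpace ℝ (Fin 3)) 1) : toUnit v ≠ 0 := by
  intro h
  have h1 := congrArg (·.imI) h
  have h2 := congrArg (·.imJ) h
  have h3 := congrArg (·.imK) h
  simp only [toUnit, Quaternion.imI_zero, Quaternion.imJ_zero, Quaternion.imK_zero] at h1 h2 h3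
  have hv : v.1 = 0 := by
    ext i
    fin_cases i
    · exact h1
    · exact h2
    · exact h3
  exact ne_zero_of_mem_unit_sphere v hv

/-- Averaging over rotations fixes real-valued slice functions. -/
lemma IsSlice.rotAverage_eq {h : ℍ[ℝ] → ℝ} (hs : IsSlice fun q => (h q : ℍ[ℝ])) :
    rotAverage (fun q => (h q : ℍ[ℝ])) = fun q => (h q : ℍ[ℝ]) := by
  funext q
  have : ∀ v, rotR (toUnit v) (fun q => (h q : ℍ[ℝ])) q = (h q : ℍ[ℝ]) := fun v => by
    rw [rotR, hs.apply_rotS (toUnit_ne_zero v), rotS_coe (inv_ne_zero (toUnit_ne_zero v))]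
  simp only [rotAverage, this]
  have : NeZero ((MeasureTheory.volume :
      MeasureTheory.Measure (EuclideanSpace ℝ (Fin 3))).toSphere) :=
    ⟨MeasureTheory.Measure.toSphere_ne_zero _⟩
  exact MeasureTheory.average_const _ _

/-! ### The operator `Δ_*` on real-valued functions -/

lemma lineDeriv_coe {h : ℍ[ℝ] → ℝ} {q : ℍ[ℝ]} (hd : DifferentiableAt ℝ h q) (v : ℍ[ℝ]) :
    lineDeriv ℝ (fun p => (h p : ℍ[ℝ])) q v = (fderiv ℝ h q v : ℍ[ℝ]) := by
  have h1 := hd.hasFDerivAt.hasLineDerivAt v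
  have h2 := (Algebra.linearMap ℝ ℍ[ℝ]).toContinuousLinearMap.hasFDerivAt.comp_hasDerivAt
    (0 : ℝ) h1
  exact HasLineDerivAt.lineDeriv h2

lemma unitOf_add_smul_one (q : ℍ[ℝ]) (t : ℝ) : unitOf (q + t • (1 : ℍ[ℝ])) = unitOf q := by
  simp [unitOf]

/-- Moving along its own slice, a point keeps its unit until it crosses the real axis, where the
unit flips sign; hence only small `t`. -/
lemma eventually_unitOf_add_smul_unitOf {q : ℍ[ℝ]} (hq : q.im ≠ 0) :
    ∀ᶠ t : ℝ in 𝓝 0, unitOf (q + t • unitOf q) = unitOf q := by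
  have hc : ContinuousAt (fun t : ℝ => ‖q.im‖ + t) 0 := by fun_prop
  have hn : 0 < ‖q.im‖ := norm_pos_iff.2 hq
  have hn' : 0 < ‖q.im‖ + 0 := by rwa [add_zero]
  filter_upwards [hc.eventually (lt_mem_nhds hn')] with t ht
  have hI := unitOf_mem_imUnits hq
  have : q + t • unitOf q = (q.re : ℍ[ℝ]) + unitOf q * ((‖q.im‖ + t : ℝ) : ℍ[ℝ]) := by
    rw [Quaternion.mul_coe_eq_smul, add_smul, norm_smul_unitOf hq, ← add_assoc,
      Quaternion.re_add_im]
  rw [this, unitOf_add_mul_coe hI, abs_of_pos ht, inv_mul_cancel₀ ht.ne', one_smul]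

/-- Since the unit is constant along the line near `q`, it acts as a constant coefficient and only
`h` gets differentiated. -/
lemma lineDeriv_dBarStar_coe {h : ℍ[ℝ] → ℝ} (hC : ContDiff ℝ 2 h) {q v : ℍ[ℝ]}
    (hv : ∀ᶠ t : ℝ in 𝓝 0, unitOf (q + t • v) = unitOf q) :
    lineDeriv ℝ (dBarStar fun p => (h p : ℍ[ℝ])) q v =
      (1 / 2 : ℝ) • ((fderiv ℝ (fderiv ℝ h) q v 1 : ℍ[ℝ]) +
        unitOf q * (fderiv ℝ (fderiv ℝ h) q v (unitOf q) : ℍ[ℝ])) := by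
  have hd : Differentiable ℝ h := hC.differentiable two_ne_zero
  have hd2 : Differentiable ℝ (fderiv ℝ h) :=
    (hC.fderiv_right (m := 1) (by norm_num)).differentiable one_ne_zero
  have h1 : ∀ u : ℍ[ℝ], HasDerivAt (fun t : ℝ => (fderiv ℝ h (q + t • v) u : ℍ[ℝ]))
      (fderiv ℝ (fderiv ℝ h) q v u : ℍ[ℝ]) 0 := fun u => by
    have a1 := ((hd2 q).hasFDerivAt.clm_apply (hasFDerivAt_const u q)).hasLineDerivAt v
    have a3 := (Algebra.linearMap ℝ ℍ[ℝ]).toContinuousLinearMap.hasFDerivAt.comp_hasDerivAt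
      (0 : ℝ) a1
    simpa [Function.comp_def] using a3
  have h2 := ((h1 1).add ((h1 (unitOf q)).const_mul (unitOf q))).const_smul (1 / 2 : ℝ)
  refine HasLineDerivAt.lineDeriv (HasDerivAt.congr_of_eventuallyEq h2 ?_)
  filter_upwards [hv] with t ht
  simp only [dBarStar, lineDeriv_coe (hd _), ht]
  rfl

/-- On real-valued functions, `Δ_*` is the Laplacian along the slice. -/
lemma laplaceStar_coe {h : ℍ[ℝ] → ℝ} (hC : ContDiff ℝ 2 h) {q : ℍ[ℝ]} (hq : q.im ≠ 0) :
    laplaceStar (fun p => (h p : ℍ[ℝ])) q =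
      ((fderiv ℝ (fderiv ℝ h) q 1 1 +
        fderiv ℝ (fderiv ℝ h) q (unitOf q) (unitOf q) : ℝ) : ℍ[ℝ]) := by
  -- Symmetry of the second derivative cancels the mixed terms, and `-I * I = 1` gives the pure
  -- second derivative along `I`.
  have hsymm : fderiv ℝ (fderiv ℝ h) q (unitOf q) 1 = fderiv ℝ (fderiv ℝ h) q 1 (unitOf q) :=
    (hC.contDiffAt.isSymmSndFDerivAt (by simp)) _ _
  rw [laplaceStar, dStar,
    lineDeriv_dBarStar_coe hC (Eventually.of_forall fun t => unitOf_add_smul_one q t),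
    lineDeriv_dBarStar_coe hC (eventually_unitOf_add_smul_unitOf hq), hsymm]
  generalize fderiv ℝ (fderiv ℝ h) q 1 1 = a
  generalize fderiv ℝ (fderiv ℝ h) q 1 (unitOf q) = b
  generalize fderiv ℝ (fderiv ℝ h) q (unitOf q) (unitOf q) = c
  rw [mul_smul_comm, mul_add, ← mul_assoc, unitOf_mul_self hq, ← smul_sub, smul_smul, smul_smul,
    Quaternion.coe_add]
  norm_num
  abel

/-! ### The restriction to a slice is harmonic -/

lemma unitOf_coeComplex (z : ℂ) :
    unitOf (z : ℍ[ℝ]) = (|z.im|⁻¹ * z.im) • imagI := by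
  rw [coeComplex_eq, unitOf_add_mul_coe imagI_mem_imUnits]

lemma laplacian_comp_coeComplex {h : ℍ[ℝ] → ℝ} (hC : ContDiff ℝ 2 h) (z : ℂ) :
    Laplacian.laplacian (fun w : ℂ => h (w : ℍ[ℝ])) z =
      fderiv ℝ (fderiv ℝ h) z 1 1 +
        fderiv ℝ (fderiv ℝ h) z imagI imagI := by
  let L : ℂ →L[ℝ] ℍ[ℝ] := Quaternion.ofComplex.toLinearMap.toContinuousLinearMap
  have hL : (fun w : ℂ => h (w : ℍ[ℝ])) = h ∘ L := rfl
  rw [hL, laplacian_eq_iteratedFDeriv_complexPlane]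
  simp only [L.iteratedFDeriv_comp_right hC z le_rfl,
    ContinuousMultilinearMap.compContinuousLinearMap_apply, iteratedFDeriv_two_apply]
  have h1 : L 1 = 1 := Quaternion.coeComplex_one
  have hI : L Complex.I = imagI := by
    change ((Complex.I : ℂ) : ℍ[ℝ]) = _
    ext <;> simp
  simp only [Matrix.cons_val_zero, Matrix.cons_val_one, h1, hI]
  rfl

lemma dense_im_ne_zero : Dense {z : ℂ | z.im ≠ 0} := by
  have h : Dense (({0} : Set ℝ)ᶜ) := dense_compl_singleton 0
  exact h.preimage Complex.isOpenMap_im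

/-- The equation is known only off the real axis; continuity of the second derivatives extends it
across. -/
lemma harmonicOnNhd_comp_coeComplex {h : ℍ[ℝ] → ℝ} (hC : ContDiff ℝ 2 h)
    (hlap : ∀ q : ℍ[ℝ], q.im ≠ 0 → laplaceStar (fun p => (h p : ℍ[ℝ])) q = 0) :
    HarmonicOnNhd (fun w : ℂ => h (w : ℍ[ℝ])) Set.univ := by
  have hcoe : ContDiff ℝ 2 (fun w : ℂ => (w : ℍ[ℝ])) :=
    (Quaternion.ofComplex.toLinearMap.toContinuousLinearMap).contDiff
  have hd2 : Continuous (fderiv ℝ (fderiv ℝ h)) :=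
    (hC.fderiv_right (m := 1) (by norm_num)).continuous_fderiv one_ne_zero
  have hzero : (fun z : ℂ => fderiv ℝ (fderiv ℝ h) z 1 1 +
      fderiv ℝ (fderiv ℝ h) z imagI imagI) = 0 := by
    have hc : Continuous (fun z : ℂ => fderiv ℝ (fderiv ℝ h) (z : ℍ[ℝ])) :=
      hd2.comp hcoe.continuous
    refine Continuous.ext_on dense_im_ne_zero ?_ continuous_const fun z hz => ?_
    · exact ((hc.clm_apply continuous_const).clm_apply continuous_const).add
        ((hc.clm_apply continuous_const).clm_apply continuous_const)
    · have hz : z.im ≠ 0 := hz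
      have hq : (z : ℍ[ℝ]).im ≠ 0 := fun h0 => hz (by simpa using congrArg (·.imI) h0)
      have h1 := hlap z hq
      rw [laplaceStar_coe hC hq, unitOf_coeComplex] at h1
      have h2 := Quaternion.coe_injective (h1.trans Quaternion.coe_zero.symm)
      -- The unit of `z` is `±imagI`; the sign enters twice and drops out.
      have h3 : (|z.im|⁻¹ * z.im) * (|z.im|⁻¹ * z.im) = 1 := by
        have : |z.im| ≠ 0 := abs_ne_zero.2 hz
        field_simp
        rw [sq_abs]
      simp only [map_smul, smul_apply, smul_smul, h3, one_smul] at h2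
      exact h2
  refine fun z _ => ⟨(hC.comp hcoe).contDiffAt, Eventually.of_forall fun w => ?_⟩
  rw [laplacian_comp_coeComplex hC]
  exact congrFun hzero w

/-! ### From conjugation-symmetric entire functions to slice regular functions -/

/-- An entire function whose real part is conjugation invariant may be chosen to commute with
conjugation without changing its real part. -/
lemma exists_entire_conj_symm {G : ℂ → ℂ} (hG : Differentiable ℂ G)
    (hre : ∀ z, (G (starRingEnd ℂ z)).re = (G z).re) :
    ∃ g : ℂ → ℂ, Differentiable ℂ g ∧ (∀ z, g (starRingEnd ℂ z) = starRingEnd ℂ (g z)) ∧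
      ∀ z, (g z).re = (G z).re := by
  refine ⟨fun z => (G z + starRingEnd ℂ (G (starRingEnd ℂ z))) / 2, ?_, fun z => ?_, fun z => ?_⟩
  · refine (hG.add fun z => ?_).div_const 2
    exact differentiableAt_conj_conj_iff.2 (hG (starRingEnd ℂ z))
  · simp only [map_div₀, map_add, Complex.conj_conj, Complex.conj_ofNat, add_comm (G _)]
  · simp [hre]

/-- The slice function induced by the stem function `Re g + (Im g) ι`. -/
noncomputable def sliceExt (g : ℂ → ℂ) (q : ℍ[ℝ]) : ℍ[ℝ] :=
  ((g ⟨q.re, ‖q.im‖⟩).re : ℍ[ℝ]) + unitOf q * ((g ⟨q.re, ‖q.im‖⟩).im : ℍ[ℝ])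

/-- The stem function `Re g + (Im g) ι`. -/
def stemOf (g : ℂ → ℂ) (z : ℂ) : ℍ[ℝ] × ℍ[ℝ] := ((g z).re, (g z).im)

section

variable {g : ℂ → ℂ}

lemma isStem_stemOf (hg : ∀ z, g (starRingEnd ℂ z) = starRingEnd ℂ (g z)) : IsStem (stemOf g) :=
  fun z => by simp [stemOf, conjIota, hg]

lemma induces_stemOf (hg : ∀ z, g (starRingEnd ℂ z) = starRingEnd ℂ (g z)) :
    Induces (stemOf g) (sliceExt g) := by
  intro α β I hI
  rw [sliceExt, re_add_mul_coe hI, norm_im_add_mul_coe hI, unitOf_add_mul_coe hI]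
  rcases lt_trichotomy β 0 with hβ | rfl | hβ
  · have h1 : (⟨α, |β|⟩ : ℂ) = starRingEnd ℂ ⟨α, β⟩ := by
      rw [abs_of_neg hβ]; rfl
    have h2 : |β|⁻¹ * β = -1 := by
      rw [abs_of_neg hβ, inv_neg, neg_mul, inv_mul_cancel₀ hβ.ne]
    rw [h1, hg, h2]
    simp [stemOf]
  -- At real points `unitOf` takes the junk value `0`; this is harmless because `g` is real on the
  -- real axis.
  · have h1 : (g ⟨α, 0⟩).im = 0 := by
      have h2 : starRingEnd ℂ (⟨α, 0⟩ : ℂ) = ⟨α, 0⟩ := by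
        apply Complex.ext <;> simp
      have h3 := hg ⟨α, 0⟩
      rw [h2] at h3
      exact Complex.conj_eq_iff_im.1 h3.symm
    simp [stemOf, h1]
  · rw [abs_of_pos hβ, inv_mul_cancel₀ hβ.ne', one_smul]
    rfl

/-- Complex linearity of the derivative of `g` is the Cauchy–Riemann condition, as multiplication by
`i` on `ℂ` becomes `mulIota` on pairs. -/
lemma isHolomorphic_stemOf (hg : Differentiable ℂ g) : IsHolomorphic (stemOf g) := by
  let A : ℝ →L[ℝ] ℍ[ℝ] := (Algebra.linearMap ℝ ℍ[ℝ]).toContinuousLinearMap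
  let B : ℂ →L[ℝ] ℍ[ℝ] × ℍ[ℝ] := (A.comp Complex.reCLM).prod (A.comp Complex.imCLM)
  have key : ∀ z, HasFDerivAt (stemOf g) (B.comp ((fderiv ℂ g z).restrictScalars ℝ)) z := fun z =>
    B.hasFDerivAt.comp z ((hg z).hasFDerivAt.restrictScalars ℝ)
  refine ⟨fun z => (key z).differentiableAt, fun z => ?_⟩
  rw [(key z).fderiv]
  have h1 : fderiv ℂ g z Complex.I = Complex.I * fderiv ℂ g z 1 := by
    simp
  have hB : ∀ w, B w = ((w.re : ℍ[ℝ]), (w.im : ℍ[ℝ])) := fun _ => rfl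
  simp only [ContinuousLinearMap.comp_apply, ContinuousLinearMap.coe_restrictScalars', h1, hB,
    mulIota]
  simp

lemma isSlicePreserving_sliceExt (hg : ∀ z, g (starRingEnd ℂ z) = starRingEnd ℂ (g z)) :
    IsSlicePreserving (sliceExt g) := by
  refine ⟨⟨_, isStem_stemOf hg, induces_stemOf hg⟩, ?_⟩
  rintro J hJ q ⟨α, β, rfl⟩
  exact ⟨_, _, induces_stemOf hg α β J hJ⟩

lemma re_sliceExt (g : ℂ → ℂ) (q : ℍ[ℝ]) : (sliceExt g q).re = (g ⟨q.re, ‖q.im‖⟩).re := by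
  simp [sliceExt, unitOf]

end

end SliceQuat

theorem proposition8 (h : ℍ[ℝ] → ℝ)
    (hC2 : ContDiff ℝ 2 h)
    (hslice : SliceQuat.IsSlice (fun q => ((h q : ℝ) : ℍ[ℝ])))
    (hlap : ∀ q : ℍ[ℝ], q.im ≠ 0 →
      SliceQuat.laplacePrime (fun p => ((h p : ℝ) : ℍ[ℝ])) q = 0) :
    ∃ f : ℍ[ℝ] → ℍ[ℝ], SliceQuat.IsSliceRegular f ∧ SliceQuat.IsSlicePreserving f ∧
      ∀ q : ℍ[ℝ], h q = (f q).re := by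
  have hlap' : ∀ q : ℍ[ℝ], q.im ≠ 0 → SliceQuat.laplaceStar (fun p => (h p : ℍ[ℝ])) q = 0 := fun q hq => by
    rw [← hlap q hq, SliceQuat.laplacePrime, hslice.rotAverage_eq]
  obtain ⟨G, hG, hGh⟩ := (SliceQuat.harmonicOnNhd_comp_coeComplex hC2
    hlap').exists_analyticOnNhd_univ_re_eq
  have hGh : ∀ z : ℂ, (G z).re = h (z : ℍ[ℝ]) := congrFun hGh
  have hconj : ∀ z, (G (starRingEnd ℂ z)).re = (G z).re := fun z => by
    have e : ((starRingEnd ℂ z : ℂ) : ℍ[ℝ]) =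
        (z.re : ℍ[ℝ]) + -SliceQuat.imagI * (z.im : ℍ[ℝ]) := by
      ext <;> simp 
    rw [hGh, hGh, e, SliceQuat.coeComplex_eq z]
    exact hslice.eq_of_real _ _ (SliceQuat.neg_mem_imUnits SliceQuat.imagI_mem_imUnits)
      SliceQuat.imagI_mem_imUnits
  obtain ⟨g, hg, hgc, hgG⟩ := SliceQuat.exists_entire_conj_symm
    (fun z => (hG z (Set.mem_univ z)).differentiableAt) hconj
  refine ⟨SliceQuat.sliceExt g, ⟨_, SliceQuat.isStem_stemOf hgc, SliceQuat.induces_stemOf hgc,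
    SliceQuat.isHolomorphic_stemOf hg⟩, SliceQuat.isSlicePreserving_sliceExt hgc, fun q => ?_⟩
  obtain ⟨I, hI, hq⟩ := SliceQuat.exists_imUnits_eq q
  rw [SliceQuat.re_sliceExt, hgG, hGh, SliceQuat.coeComplex_eq]
  conv_lhs => rw [hq]
  exact hslice.eq_of_real _ _ hI SliceQuat.imagI_mem_imUnits
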